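/- **Definitions.** A dcpo is a partial order in which every non-empty directed subset has a least upper bound. An element $k$ of a dcpo $D$ is compact if, whenever $k\le\bigvee A$ for a non-empty directed set $A$, there is $a\in A$ with $k\le a$. A dcpo $D$ is an algebraic domain if for every $d\in D$ the set of compact elements below $d$ is non-empty and directed with least upper bound $d$. Let $\max(D)=\{m\in D\mid \forall d\in D\colon m\le d\Rightarrow m=d\}$, with the topology $\tau_{\max(D)}=\{U\cap\max(D)\mid U \text{ Scott-open in } D\}$. The domain $D$ satisfies the Lawson condition if $\tau_{\max(D)}=\{V\cap\max(D)\mid V\text{ Lawson-open in }D\}$, where the Lawson topology is generated by the Scott-open sets and the complements of the sets $\{e\in D\mid d\le e\}$, $d\in D$. A space is zero-dimensional if every open set is a union of clopen sets. The mixed powerdomain $\mathcal M(D)$ consists of the pairs $(L,U)$ with $L\subseteq D$ Scott-closed, $U\subseteq D$ Scott-compact and upper, and $L={\downarrow}(L\cap U)$, ordered by $(L,U)\le(L',U')$ iff $L\subseteq L'$ and $U'\subseteq U$. For a finite set $\mathit{Act}$ let $\mathbb D$ be the initial solution, over bifinite domains, of $D=\prod_{\alpha\in\mathit{Act}}\mathcal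 M(D)$. Explicitly, with $F(D)=\prod_{\alpha\in\mathit{Act}}\mathcal M(D)$, it is the inverse limit, ordered componentwise, of the finite posets $F^n(1)$ along the projections $p_n\colon F^{n+1}(1)\to F^n(1)$, where $p_0$ is the unique map, $p_{n+1}=F(p_n)$, and $\mathcal M$ acts on a monotone map $f$ of finite posets by $(L,U)\mapsto({\downarrow}f(L),{\uparrow}f(U))$. **Proposition.** (1) For every finite set $\mathit{Act}$, the maximal-points space $(\mathbb X,\tau_{\mathbb X})$ with $\mathbb X=\max(\mathbb D)$ is zero-dimensional and Hausdorff. (2) More generally, for every algebraic domain $D$ satisfying the Lawson condition, the space $(\max(D),\tau_{\max(D)})$ is zero-dimensional and Hausdorff. -/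

import Mathlib

namespace ModalDomain

open Set Topology

universe u

/-! ### Domains, maximal points, zero-dimensionality -/

/-- A topological space is zero-dimensional if every open set is a union of clopen sets. -/
def IsZeroDimensional (X : Type*) [TopologicalSpace X] : Prop :=
  ∀ O : Set X, IsOpen O → ∃ S : Set (Set X), (∀ C ∈ S, IsClopen C) ∧ O = ⋃₀ S

/-- The set `max(D)` of maximal elements of a partial order, as a type. -/
def MaximalPoints (D : Type*) [PartialOrder D] : Type _ :=
  {m : D // ∀ d : D, m ≤ d → m = d}

/-- The inclusion of `max(D)` into `D`. -/
def MaximalPoints.val {D : Type*} [PartialOrder D] (x : MaximalPoints D) : D := Subtype.val x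

/-- The maximal-points space topology: the open sets are the sets `U ∩ max(D)` for `U` Scott-open
in `D`. -/
instance MaximalPoints.instTopologicalSpace (D : Type*) [PartialOrder D] :
    TopologicalSpace (MaximalPoints D) :=
  (scott D univ).induced MaximalPoints.val

/-- A dcpo: every (non-empty) directed subset has a least upper bound. -/
def IsDcpo (D : Type*) [PartialOrder D] : Prop :=
  ∀ A : Set D, A.Nonempty → DirectedOn (· ≤ ·) A → ∃ s, IsLUB A s

/-- An algebraic domain: a dcpo in which, for every `d`, the set of compact elements below `d` is
(non-empty and) directed with least upper bound `d`. -/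
structure IsAlgebraicDomain (D : Type*) [PartialOrder D] : Prop where
  dcpo : IsDcpo D
  nonempty_compact : ∀ d : D, {k : D | IsCompactElement k ∧ k ≤ d}.Nonempty
  directed_compact : ∀ d : D, DirectedOn (· ≤ ·) {k : D | IsCompactElement k ∧ k ≤ d}
  isLUB_compact : ∀ d : D, IsLUB {k : D | IsCompactElement k ∧ k ≤ d} d

/-- The Lawson condition: the Scott topology and the Lawson topology of `D` induce the same topology
on `max(D)`. -/
def LawsonCondition (D : Type*) [PartialOrder D] : Prop :=
  (scott D univ).induced (MaximalPoints.val (D := D)) =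
    (lawson D).induced (MaximalPoints.val (D := D))

/-! ### The mixed powerdomain -/

/-- The mixed powerdomain of `D`: pairs `(L, U)` with `L` Scott-closed, `U` Scott-compact and
saturated (that is, upper), satisfying the mix condition `L = ↓(L ∩ U)`. -/
@[ext]
structure MixedPowerdomain (D : Type u) [PartialOrder D] : Type u where
  /-- The component `L`. -/
  low : Set D
  /-- The component `U`. -/
  up : Set D
  isClosed_low : IsClosed[scott D univ] low
  isCompact_up : @IsCompact D (scott D univ) up
  isUpperSet_up : IsUpperSet up
  mix : low = {d | ∃ x ∈ low ∩ up, d ≤ x}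

namespace MixedPowerdomain

/-- `(L, U) ≤ (L', U')` iff `L ⊆ L'` and `U' ⊆ U`. -/
instance instPartialOrder (D : Type u) [PartialOrder D] : PartialOrder (MixedPowerdomain D) where
  le P Q := P.low ⊆ Q.low ∧ Q.up ⊆ P.up
  le_refl _ := ⟨Subset.rfl, Subset.rfl⟩
  le_trans _ _ _ h h' := ⟨h.1.trans h'.1, h'.2.trans h.2⟩
  le_antisymm _ _ h h' :=
    MixedPowerdomain.ext (h.1.antisymm h'.1) (h'.2.antisymm h.2)

instance instFinite (D : Type u) [PartialOrder D] [Finite D] : Finite (MixedPowerdomain D) :=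
  Finite.of_injective (fun P : MixedPowerdomain D => (P.low, P.up)) fun _ _ h =>
    MixedPowerdomain.ext (congrArg Prod.fst h) (congrArg Prod.snd h)

/-- In a finite partial order every lower set is Scott-closed. -/
theorem isClosed_scott_of_isLowerSet {D : Type*} [PartialOrder D] [Finite D] {s : Set D}
    (hs : IsLowerSet s) : IsClosed[scott D univ] s := by
  let _ : TopologicalSpace D := scott D univ
  have : IsScott D univ := ⟨rfl⟩
  refine IsScott.isClosed_iff_isLowerSet_and_dirSupClosed.2 ⟨hs, ?_⟩
  intro d hds hne hdir a ha
  obtain ⟨m, hm⟩ := (toFinite d).exists_maximal hne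
  have hup : a ≤ m := ha.2 fun x hx => by
    obtain ⟨z, hz, hxz, hmz⟩ := hdir x hx m hm.1
    exact hxz.trans (hm.2 hz hmz)
  exact hs hup (hds hm.1)

/-- The action of the mixed powerdomain functor on monotone maps between finite partial orders:
`(L, U) ↦ (↓f(L), ↑f(U))`. -/
def map {D E : Type u} [PartialOrder D] [PartialOrder E] [Finite E] (f : D →o E) :
    MixedPowerdomain D →o MixedPowerdomain E where
  toFun P :=
    { low := {e | ∃ x ∈ P.low, e ≤ f x}
      up := {e | ∃ x ∈ P.up, f x ≤ e}
      isClosed_low := isClosed_scott_of_isLowerSet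
        fun _ _ hba ⟨x, hx, hax⟩ => ⟨x, hx, hba.trans hax⟩
      isCompact_up := @Set.Finite.isCompact E (scott E univ) _ (toFinite _)
      isUpperSet_up := fun _ _ hab ⟨x, hx, hxa⟩ => ⟨x, hx, hxa.trans hab⟩
      mix := by
        ext e
        constructor
        · rintro ⟨x, hx, hex⟩
          rw [P.mix] at hx
          obtain ⟨y, hy, hxy⟩ := hx
          exact ⟨f y, ⟨⟨y, hy.1, le_rfl⟩, ⟨y, hy.2, le_rfl⟩⟩, hex.trans (f.monotone hxy)⟩
        · rintro ⟨y, ⟨⟨x, hx, hyx⟩, _⟩, hey⟩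
          exact ⟨x, hx, hey.trans hyx⟩ }
  monotone' _ _ h :=
    ⟨fun _ ⟨x, hx, hex⟩ => ⟨x, h.1 hx, hex⟩, fun _ ⟨x, hx, hxe⟩ => ⟨x, h.2 hx, hxe⟩⟩

end MixedPowerdomain

/-! ### The initial solution of `D = ∏_{α ∈ Act} M(D)`

With `F(D) = ∏_{α ∈ Act} M(D)`, the initial solution is the bilimit of the chain
`1 ⇄ F(1) ⇄ F(F(1)) ⇄ ⋯` of (finite) domains and embedding-projection pairs, where `1 ⇄ F(1)` is
the only such pair and the others arise from it by applying `F`. As for every such chain, the bilimit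
is the inverse limit along the projections, ordered componentwise. -/

/-- The finite stages `F^n(1)`. -/
noncomputable def stage (Act : Type u) [Finite Act] : ℕ → FinPartOrd.{u}
  | 0 => FinPartOrd.of PUnit
  | n + 1 =>
    letI : Fintype (Act → MixedPowerdomain (stage Act n)) := Fintype.ofFinite _
    FinPartOrd.of (Act → MixedPowerdomain (stage Act n))

/-- The projections `F^(n+1)(1) → F^n(1)`: the unique map for `n = 0`, and `F` applied to the
previous projection otherwise. -/
noncomputable def proj (Act : Type u) [Finite Act] : (n : ℕ) → stage Act (n + 1) →o stage Act n
  | 0 => ⟨fun _ => PUnit.unit, fun _ _ _ => le_rfl⟩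
  | n + 1 =>
    { toFun := fun (x : Act → MixedPowerdomain (stage Act (n + 1))) =>
        (fun α => MixedPowerdomain.map (proj Act n) (x α) :
          Act → MixedPowerdomain (stage Act n))
      monotone' := fun _ _ h α => (MixedPowerdomain.map (proj Act n)).monotone (h α) }

/-- The domain of modal transition systems over the events `Act`: the initial solution of
`D = ∏_{α ∈ Act} M(D)`. -/
def ModalDom (Act : Type u) [Finite Act] : Type u :=
  {x : (n : ℕ) → stage Act n // ∀ n, proj Act n (x (n + 1)) = x n}

noncomputable instance ModalDom.instPartialOrder (Act : Type u) [Finite Act] :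
    PartialOrder (ModalDom Act) :=
  inferInstanceAs (PartialOrder
    {x : (n : ℕ) → stage Act n // ∀ n, proj Act n (x (n + 1)) = x n})

end ModalDomain

/-!
Both parts exhibit a basis of the maximal-points space that consists of clopen sets. Since the
Scott topology of a partial order is `T₀`, such a basis makes the space totally separated, hence
Hausdorff (`isZeroDimensional_and_t2Space_of_clopen_nhds`).

For an algebraic domain the up-sets `↑k` of compact elements `k` form a basis of the Scott topology.
The complement of `↑k` is Lawson-open, so under the Lawson condition its trace on the maximal points
is open, and the trace of `↑k` is clopen.

In the initial solution `𝔻` of `D = ∏_{α ∈ Act} M(D)`, the Scott topology has the sets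
`{y | a ≤ y n}` as a basis, where `a` is an element of the `n`-th finite stage: directed suprema in
the inverse limit are reached at each stage (`exists_mem_apply_eq_of_isLUB`), and every element is
the supremum of the embedded images of its components (`exists_least_extension`). The trace of such
a set on the maximal points is clopen because every component `m n` of a maximal point `m` is
maximal in its stage (`isMax_apply`): for maximal `y`, if `m n ≤ y n` then `y n = m n`, so `y n` is
locally constant. The maximality of the components rests on a lifting property of the
projections (`exists_isMax_proj_eq`): if `b` is maximal and `p x ≤ b`, then `b = p c` for some
maximal `c` above `x`. It passes from `p` to `F(p)` because the maximal elements of `M(E)`, for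
finite `E`, are the pairs `(↓X, ↑X)` with `X` a set of maximal elements of `E`
(`MixedPowerdomain.isMax_iff`).
-/

namespace ModalDomain

open Set Topology

/-! ### Scott-open sets and maximal points -/

theorem isOpen_scott_iff {D : Type*} [PartialOrder D] {U : Set D} :
    IsOpen[scott D univ] U ↔ IsUpperSet U ∧ ∀ A : Set D, A.Nonempty → DirectedOn (· ≤ ·) A →
      ∀ s, IsLUB A s → s ∈ U → ∃ a ∈ A, a ∈ U := by
  let _ : TopologicalSpace D := scott D univ
  have : IsScott D univ := ⟨rfl⟩
  rw [IsScott.isOpen_iff_isUpperSet_and_dirSupInaccOn (D := univ)]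
  exact and_congr_right fun _ =>
    ⟨fun h A hne hdir s hs hsU => h (mem_univ A) hne hdir hs hsU,
      fun h A _ hne hdir s hs hsU => h A hne hdir s hs hsU⟩

theorem MaximalPoints.val_injective (D : Type*) [PartialOrder D] :
    Function.Injective (MaximalPoints.val (D := D)) :=
  Subtype.val_injective

theorem MaximalPoints.isMax_val {D : Type*} [PartialOrder D] (x : MaximalPoints D) :
    IsMax x.val :=
  fun _ h => (x.2 _ h).ge

theorem MaximalPoints.isOpen_preimage {D : Type*} [PartialOrder D] {U : Set D}
    (hU : IsOpen[scott D univ] U) : IsOpen (MaximalPoints.val ⁻¹' U) :=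
  (isOpen_induced_iff (t := scott D univ)).2 ⟨U, hU, rfl⟩

instance MaximalPoints.instT0Space (D : Type*) [PartialOrder D] : T0Space (MaximalPoints D) := by
  let _ : TopologicalSpace D := scott D univ
  have : IsScott D univ := ⟨rfl⟩
  exact t0Space_of_injective_of_continuous (MaximalPoints.val_injective D) continuous_induced_dom

/-- If every Scott-open neighbourhood of a maximal point contains a smaller neighbourhood with
clopen trace on the maximal points, then the maximal-points space is zero-dimensional and
Hausdorff. -/
theorem isZeroDimensional_and_t2Space_of_clopen_nhds {D : Type*} [PartialOrder D]
    (h : ∀ (U : Set D), IsOpen[scott D univ] U → ∀ m : MaximalPoints D, m.val ∈ U →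
      ∃ V ⊆ U, m.val ∈ V ∧ IsClopen (MaximalPoints.val (D := D) ⁻¹' V)) :
    IsZeroDimensional (MaximalPoints D) ∧ T2Space (MaximalPoints D) := by
  have hb : TopologicalSpace.IsTopologicalBasis {s : Set (MaximalPoints D) | IsClopen s} := by
    refine TopologicalSpace.isTopologicalBasis_of_isOpen_of_nhds (fun s hs => hs.isOpen) ?_
    intro m O hm hO
    obtain ⟨U, hU, rfl⟩ := (isOpen_induced_iff (t := scott D univ)).1 hO
    obtain ⟨V, hVU, hmV, hV⟩ := h U hU m hm
    exact ⟨_, hV, hmV, preimage_mono hVU⟩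
  refine ⟨fun O hO => ?_, ?_⟩
  · obtain ⟨S, hS, rfl⟩ := hb.open_eq_sUnion hO
    exact ⟨S, hS, rfl⟩
  · have := totallySeparatedSpace_of_t0_of_basis_clopen hb
    infer_instance

/-! ### Algebraic domains satisfying the Lawson condition -/

theorem isOpen_scott_Ici {D : Type*} [PartialOrder D] {k : D} (hk : IsCompactElement k) :
    IsOpen[scott D univ] (Ici k) :=
  isOpen_scott_iff.2 ⟨isUpperSet_Ici k, fun A hne hdir s hs hks => hk A s hne hdir hs hks⟩

theorem isOpen_lawson_compl_Ici {D : Type*} [PartialOrder D] (d : D) :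
    IsOpen[lawson D] (Ici d)ᶜ :=
  lawson_le_lower _ (TopologicalSpace.isOpen_generateFrom_of_mem ⟨d, rfl⟩)

theorem LawsonCondition.isClopen_preimage_Ici {D : Type*} [PartialOrder D]
    (hL : LawsonCondition D) {k : D} (hk : IsCompactElement k) :
    IsClopen (MaximalPoints.val (D := D) ⁻¹' Ici k) := by
  refine ⟨⟨?_⟩, MaximalPoints.isOpen_preimage (isOpen_scott_Ici hk)⟩
  change IsOpen[(scott D univ).induced (MaximalPoints.val (D := D))] _
  rw [hL]
  exact (isOpen_induced_iff (t := lawson D)).2 ⟨(Ici k)ᶜ, isOpen_lawson_compl_Ici k, rfl⟩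

theorem IsAlgebraicDomain.isZeroDimensional_and_t2Space {D : Type*} [PartialOrder D]
    (hD : IsAlgebraicDomain D) (hL : LawsonCondition D) :
    IsZeroDimensional (MaximalPoints D) ∧ T2Space (MaximalPoints D) := by
  refine isZeroDimensional_and_t2Space_of_clopen_nhds fun U hU m hm => ?_
  obtain ⟨hup, hacc⟩ := isOpen_scott_iff.1 hU
  obtain ⟨k, ⟨hk, hkm⟩, hkU⟩ := hacc _ (hD.nonempty_compact m.val) (hD.directed_compact m.val)
    m.val (hD.isLUB_compact m.val) hm
  exact ⟨Ici k, hup.Ici_subset hkU, hkm, hL.isClopen_preimage_Ici hk⟩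

/-! ### The mixed powerdomain of a finite poset -/

theorem exists_isMax_ge {E : Type*} [PartialOrder E] [Finite E] (a : E) :
    ∃ b, a ≤ b ∧ IsMax b := by
  obtain ⟨b, hab, hb⟩ := (toFinite (univ : Set E)).exists_le_maximal (mem_univ a)
  exact ⟨b, hab, fun c hc => hb.2 (mem_univ c) hc⟩

namespace MixedPowerdomain

universe u

theorem mem_low_of_le {D : Type*} [PartialOrder D] (P : MixedPowerdomain D) {d e : D}
    (hde : d ≤ e) (he : e ∈ P.low) : d ∈ P.low := by
  rw [P.mix] at he ⊢
  obtain ⟨x, hx, hex⟩ := he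
  exact ⟨x, hx, hde.trans hex⟩

theorem exists_ge_mem_low_inter_up {D : Type*} [PartialOrder D] (P : MixedPowerdomain D) {d : D}
    (hd : d ∈ P.low) : ∃ x ∈ P.low ∩ P.up, d ≤ x := by
  rw [P.mix] at hd
  exact hd

/-- The element `(↓X, ↑X)` of the mixed powerdomain of a finite poset. -/
def ofSet {E : Type*} [PartialOrder E] [Finite E] (X : Set E) : MixedPowerdomain E where
  low := {e | ∃ x ∈ X, e ≤ x}
  up := {e | ∃ x ∈ X, x ≤ e}
  isClosed_low := isClosed_scott_of_isLowerSet fun _ _ hba ⟨x, hx, hax⟩ => ⟨x, hx, hba.trans hax⟩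
  isCompact_up := @Set.Finite.isCompact E (scott E univ) _ (toFinite _)
  isUpperSet_up := fun _ _ hab ⟨x, hx, hxa⟩ => ⟨x, hx, hxa.trans hab⟩
  mix := by
    ext e
    constructor
    · rintro ⟨x, hx, hex⟩
      exact ⟨x, ⟨⟨x, hx, le_rfl⟩, ⟨x, hx, le_rfl⟩⟩, hex⟩
    · rintro ⟨y, ⟨⟨x, hx, hyx⟩, _⟩, hey⟩
      exact ⟨x, hx, hey.trans hyx⟩

theorem isMax_ofSet {E : Type*} [PartialOrder E] [Finite E] {X : Set E}
    (hX : ∀ x ∈ X, IsMax x) : IsMax (ofSet X) := by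
  intro Q hQ
  refine ⟨fun d hd => ?_, ?_⟩
  · obtain ⟨y, hy, hdy⟩ := Q.exists_ge_mem_low_inter_up hd
    obtain ⟨x, hx, hxy⟩ := hQ.2 hy.2
    exact ⟨x, hx, hdy.trans (hX x hx hxy)⟩
  · rintro e ⟨x, hx, hxe⟩
    obtain ⟨y, hy, hxy⟩ := Q.exists_ge_mem_low_inter_up (hQ.1 ⟨x, hx, le_rfl⟩)
    exact Q.isUpperSet_up ((hX x hx hxy).trans hxe) hy.2

theorem isMax_iff {E : Type*} [PartialOrder E] [Finite E] {P : MixedPowerdomain E} :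
    IsMax P ↔ ∃ X : Set E, (∀ x ∈ X, IsMax x) ∧ P = ofSet X := by
  constructor
  · intro hP
    refine ⟨{x | IsMax x ∧ ∃ y ∈ P.low ∩ P.up, y ≤ x}, fun x hx => hx.1, ?_⟩
    refine hP.eq_of_le ⟨fun d hd => ?_, ?_⟩
    · obtain ⟨y, hy, hdy⟩ := P.exists_ge_mem_low_inter_up hd
      obtain ⟨x, hyx, hx⟩ := exists_isMax_ge y
      exact ⟨x, ⟨hx, y, hy, hyx⟩, hdy.trans hyx⟩
    · rintro e ⟨x, ⟨-, y, hy, hyx⟩, hxe⟩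
      exact P.isUpperSet_up (hyx.trans hxe) hy.2
  · rintro ⟨X, hX, rfl⟩
    exact isMax_ofSet hX

theorem map_ofSet {E E' : Type u} [PartialOrder E] [Finite E] [PartialOrder E'] [Finite E']
    (f : E →o E') (X : Set E) : map f (ofSet X) = ofSet (f '' X) := by
  ext e
  · constructor
    · rintro ⟨y, ⟨x, hx, hyx⟩, hey⟩
      exact ⟨f x, mem_image_of_mem f hx, hey.trans (f.monotone hyx)⟩
    · rintro ⟨_, ⟨x, hx, rfl⟩, hex⟩
      exact ⟨x, ⟨x, hx, le_rfl⟩, hex⟩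
  · constructor
    · rintro ⟨y, ⟨x, hx, hxy⟩, hye⟩
      exact ⟨f x, mem_image_of_mem f hx, (f.monotone hxy).trans hye⟩
    · rintro ⟨_, ⟨x, hx, rfl⟩, hxe⟩
      exact ⟨x, ⟨x, hx, le_rfl⟩, hxe⟩

/-- The functor `M` preserves the property of a monotone map that every maximal element above `f x`
is the image of a maximal element above `x`. -/
theorem exists_isMax_map_eq {E E' : Type u} [PartialOrder E] [Finite E] [PartialOrder E']
    [Finite E'] (f : E →o E')
    (hf : ∀ x b, IsMax b → f x ≤ b → ∃ c, IsMax c ∧ x ≤ c ∧ f c = b)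
    (P : MixedPowerdomain E) (Q : MixedPowerdomain E') (hQ : IsMax Q) (hPQ : map f P ≤ Q) :
    ∃ R, IsMax R ∧ P ≤ R ∧ map f R = Q := by
  obtain ⟨Y, hY, rfl⟩ := isMax_iff.1 hQ
  -- `X` collects all maximal lifts of points of `Y` to points above `P.up`.
  let X : Set E := {c | IsMax c ∧ f c ∈ Y ∧ ∃ u ∈ P.up, u ≤ c}
  refine ⟨ofSet X, isMax_ofSet fun x hx => hx.1, ⟨fun d hd => ?_, ?_⟩, ?_⟩
  · obtain ⟨x, hx, hdx⟩ := P.exists_ge_mem_low_inter_up hd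
    obtain ⟨y, hy, hxy⟩ := hPQ.1 ⟨x, hx.1, le_rfl⟩
    obtain ⟨c, hc, hxc, rfl⟩ := hf x y (hY y hy) hxy
    exact ⟨c, ⟨hc, hy, x, hx.2, hxc⟩, hdx.trans hxc⟩
  · rintro e ⟨c, ⟨-, -, u, hu, huc⟩, hce⟩
    exact P.isUpperSet_up (huc.trans hce) hu
  · rw [map_ofSet]
    congr 1
    refine Subset.antisymm (image_subset_iff.2 fun c hc => hc.2.1) fun y hy => ?_
    obtain ⟨u, hu, huy⟩ := hPQ.2 ⟨y, hy, le_rfl⟩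
    obtain ⟨c, hc, huc, rfl⟩ := hf u y (hY y hy) huy
    exact ⟨c, ⟨hc, hy, u, hu, huc⟩, rfl⟩

theorem map_map_le {D E : Type u} [PartialOrder D] [Finite D] [PartialOrder E] [Finite E]
    {f : E →o D} {g : D →o E} (h : ∀ x, f (g x) ≤ x) (P : MixedPowerdomain D) :
    map f (map g P) ≤ P := by
  refine ⟨?_, fun x hx => ⟨g x, ⟨x, hx, le_rfl⟩, h x⟩⟩
  rintro e ⟨y, ⟨x, hx, hyx⟩, hey⟩
  exact P.mem_low_of_le (hey.trans ((f.monotone hyx).trans (h x))) hx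

theorem le_map_map {D E : Type u} [PartialOrder D] [Finite D] [PartialOrder E] [Finite E]
    {f : E →o D} {g : D →o E} (h : ∀ x, x ≤ f (g x)) (P : MixedPowerdomain D) :
    P ≤ map f (map g P) := by
  refine ⟨fun x hx => ⟨g x, ⟨x, hx, le_rfl⟩, h x⟩, ?_⟩
  rintro e ⟨y, ⟨x, hx, hxy⟩, hye⟩
  exact P.isUpperSet_up ((h x).trans ((f.monotone hxy).trans hye)) hx

/-- The least element `(∅, D)` of the mixed powerdomain of a finite poset `D`. -/
instance instOrderBot (D : Type*) [PartialOrder D] [Finite D] : OrderBot (MixedPowerdomain D) where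
  bot :=
    { low := ∅
      up := univ
      isClosed_low := isClosed_scott_of_isLowerSet isLowerSet_empty
      isCompact_up := @Set.Finite.isCompact D (scott D univ) _ (toFinite _)
      isUpperSet_up := isUpperSet_univ
      mix := by simp }
  bot_le P := ⟨empty_subset _, subset_univ _⟩

end MixedPowerdomain

/-! ### The finite stages of the initial solution -/

section Stage

universe u

variable {Act : Type u} [Finite Act]

/-- The embeddings `F^n(1) → F^(n+1)(1)` matching the projections: the constant map to the least
element for `n = 0`, and `F` applied to the previous embedding otherwise. -/
noncomputable def emb (Act : Type u) [Finite Act] : (n : ℕ) → stage Act n →o stage Act (n + 1)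
  | 0 => ⟨fun _ => (fun _ => ⊥ : Act → MixedPowerdomain (stage Act 0)), fun _ _ _ => le_rfl⟩
  | n + 1 =>
    { toFun := fun (x : Act → MixedPowerdomain (stage Act n)) =>
        (fun α => MixedPowerdomain.map (emb Act n) (x α) :
          Act → MixedPowerdomain (stage Act (n + 1)))
      monotone' := fun _ _ h α => (MixedPowerdomain.map (emb Act n)).monotone (h α) }

theorem proj_emb : ∀ (n : ℕ) (a : stage Act n), proj Act n (emb Act n a) = a
  | 0, _ => rfl
  | n + 1, a => funext fun α => le_antisymm
      (MixedPowerdomain.map_map_le (fun x => (proj_emb n x).le)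
        ((a : Act → MixedPowerdomain (stage Act n)) α))
      (MixedPowerdomain.le_map_map (fun x => (proj_emb n x).ge)
        ((a : Act → MixedPowerdomain (stage Act n)) α))

theorem emb_proj_le : ∀ (n : ℕ) (a : stage Act (n + 1)), emb Act n (proj Act n a) ≤ a
  | 0, _ => fun _ => bot_le
  | n + 1, a => fun α =>
      MixedPowerdomain.map_map_le (emb_proj_le n)
        ((a : Act → MixedPowerdomain (stage Act (n + 1))) α)

theorem isMax_pi {ι : Type*} {E : ι → Type*} [∀ i, PartialOrder (E i)] {x : ∀ i, E i} :
    IsMax x ↔ ∀ i, IsMax (x i) := by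
  classical
  refine ⟨fun h i b hb => ?_, fun h y hy i => h i (hy i)⟩
  simpa using h (le_update_iff.2 ⟨hb, fun _ _ => le_rfl⟩ : x ≤ Function.update x i b) i

/-- Every maximal element above `p x` is the image under the projection `p` of a maximal element
above `x`. -/
theorem exists_isMax_proj_eq : ∀ (n : ℕ) (x : stage Act (n + 1)) (b : stage Act n), IsMax b →
    proj Act n x ≤ b → ∃ c, IsMax c ∧ x ≤ c ∧ proj Act n c = b
  | 0, x, b => fun _ _ => by
    obtain ⟨c, hxc, hc⟩ := exists_isMax_ge x
    exact ⟨c, hc, hxc, rfl⟩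
  | n + 1, x, b => fun hb hxb => by
    have hb' := (isMax_pi (E := fun _ : Act => MixedPowerdomain (stage Act n))).1 hb
    choose c hc hxc hcb using fun α => MixedPowerdomain.exists_isMax_map_eq (proj Act n)
      (exists_isMax_proj_eq n) (x α) (b α) (hb' α) (hxb α)
    exact ⟨c, (isMax_pi (E := fun _ : Act => MixedPowerdomain (stage Act (n + 1)))).2 hc, hxc,
      funext hcb⟩

/-! ### The initial solution -/

namespace ModalDom

theorem proj_apply (x : ModalDom Act) (n : ℕ) : proj Act n (x.1 (n + 1)) = x.1 n :=
  x.2 n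

theorem exists_ge_forall_isMax (x : ModalDom Act) : ∃ y, x ≤ y ∧ ∀ n, IsMax (y.1 n) := by
  obtain ⟨c₀, hxc₀, hc₀⟩ := exists_isMax_ge (x.1 0)
  have step : ∀ n (b : {b : stage Act n // IsMax b ∧ x.1 n ≤ b}),
      ∃ c : {c : stage Act (n + 1) // IsMax c ∧ x.1 (n + 1) ≤ c}, proj Act n c.1 = b.1 := by
    intro n b
    obtain ⟨c, hc, hxc, hcb⟩ := exists_isMax_proj_eq n (x.1 (n + 1)) b.1 b.2.1
      ((x.proj_apply n).le.trans b.2.2)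
    exact ⟨⟨c, hc, hxc⟩, hcb⟩
  choose next hnext using step
  let y : (n : ℕ) → {b : stage Act n // IsMax b ∧ x.1 n ≤ b} :=
    fun n => Nat.rec ⟨c₀, hc₀, hxc₀⟩ next n
  exact ⟨⟨fun n => (y n).1, fun n => hnext n (y n)⟩, fun n => (y n).2.2, fun n => (y n).2.1⟩

theorem isMax_apply {x : ModalDom Act} (hx : IsMax x) (n : ℕ) : IsMax (x.1 n) := by
  obtain ⟨y, hxy, hy⟩ := exists_ge_forall_isMax x
  rw [hx.eq_of_le hxy]
  exact hy n

/-- Since the stages are finite, directed suprema are computed componentwise and each component of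
the supremum is attained. -/
theorem exists_mem_apply_eq_of_isLUB {A : Set (ModalDom Act)} (hne : A.Nonempty)
    (hdir : DirectedOn (· ≤ ·) A) {s : ModalDom Act} (hs : IsLUB A s) (n : ℕ) :
    ∃ a ∈ A, a.1 n = s.1 n := by
  have greatest : ∀ k, ∃ a ∈ A, ∀ b ∈ A, b.1 k ≤ a.1 k := by
    intro k
    obtain ⟨_, ⟨⟨a, ha, rfl⟩, hmax⟩⟩ :=
      (toFinite ((fun a : ModalDom Act => a.1 k) '' A)).exists_maximal (hne.image _)
    refine ⟨a, ha, fun b hb => ?_⟩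
    obtain ⟨c, hc, hac, hbc⟩ := hdir a ha b hb
    exact (hbc k).trans (hmax (mem_image_of_mem _ hc) (hac k))
  choose g hg hgmax using greatest
  let t : ModalDom Act := ⟨fun k => (g k).1 k, fun k => by
    obtain ⟨c, hc, h₁, h₂⟩ := hdir (g k) (hg k) (g (k + 1)) (hg (k + 1))
    have hk : (g k).1 k = c.1 k := le_antisymm (h₁ k) (hgmax k c hc)
    have hk' : (g (k + 1)).1 (k + 1) = c.1 (k + 1) :=
      le_antisymm (h₂ (k + 1)) (hgmax (k + 1) c hc)
    exact (congrArg (proj Act k) hk').trans ((c.proj_apply k).trans hk.symm)⟩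
  have hst : s ≤ t := hs.2 fun b hb k => hgmax k b hb
  exact ⟨g n, hg n, le_antisymm (hs.1 (hg n) n) (hst n)⟩

/-- An element `a` of the `n`-th stage extends to a compatible sequence, by projecting below `n` and
embedding above `n`. -/
theorem exists_extension (n : ℕ) (a : stage Act n) :
    ∃ z : ModalDom Act, z.1 n = a ∧ ∀ k, n ≤ k → z.1 (k + 1) = emb Act k (z.1 k) := by
  have below : ∀ (n : ℕ) (a : stage Act n), ∃ s : (k : ℕ) → stage Act k,
      s n = a ∧ ∀ k < n, proj Act k (s (k + 1)) = s k := by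
    intro n
    induction n with
    | zero =>
      intro a
      exact ⟨fun k => Nat.rec a (fun k => emb Act k) k, rfl, fun k hk => absurd hk k.not_lt_zero⟩
    | succ n ih =>
      intro a
      obtain ⟨s, hs, hsp⟩ := ih (proj Act n a)
      refine ⟨Function.update s (n + 1) a, Function.update_self .., fun k hk => ?_⟩
      rw [Function.update_of_ne hk.ne]
      obtain rfl | hkn := (Nat.lt_succ_iff.1 hk).eq_or_lt
      · rw [Function.update_self, hs]
      · rw [Function.update_of_ne (Nat.succ_lt_succ hkn).ne, hsp k hkn]
  obtain ⟨s, hs, hsp⟩ := below n a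
  let t : (k : ℕ) → stage Act k :=
    fun k => Nat.rec (s 0) (fun k b => if k < n then s (k + 1) else emb Act k b) k
  have ht : ∀ k, t (k + 1) = if k < n then s (k + 1) else emb Act k (t k) := fun _ => rfl
  have hts : ∀ k ≤ n, t k = s k := by
    rintro (_ | k) hk
    · rfl
    · exact (ht k).trans (if_pos hk)
  refine ⟨⟨t, fun k => ?_⟩, (hts n le_rfl).trans hs, fun k hk => ?_⟩
  · by_cases hk : k < n
    · rw [hts (k + 1) hk, hts k hk.le, hsp k hk]
    · rw [ht, if_neg hk, proj_emb]
  · exact (ht k).trans (if_neg hk.not_gt)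

theorem exists_least_extension (n : ℕ) (a : stage Act n) :
    ∃ z : ModalDom Act, z.1 n = a ∧ ∀ y : ModalDom Act, a ≤ y.1 n → z ≤ y := by
  obtain ⟨z, rfl, hz⟩ := exists_extension n a
  refine ⟨z, rfl, fun y hy k => ?_⟩
  obtain hkn | hnk := le_total k n
  · induction hkn using Nat.decreasingInduction with
    | self => exact hy
    | of_succ k _ ih =>
      rw [← z.proj_apply, ← y.proj_apply]
      exact (proj Act k).monotone ih
  · induction k, hnk using Nat.le_induction with
    | base => exact hy
    | succ k hnk ih =>
      rw [hz k hnk]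
      refine ((emb Act k).monotone ih).trans ?_
      rw [← y.proj_apply]
      exact emb_proj_le k _

theorem isOpen_scott_setOf_le_apply (n : ℕ) (a : stage Act n) :
    IsOpen[scott (ModalDom Act) univ] {y | a ≤ y.1 n} := by
  refine isOpen_scott_iff.2 ⟨fun y z hyz hy => le_trans hy (hyz n), ?_⟩
  intro A hne hdir s hs has
  obtain ⟨b, hb, hbs⟩ := exists_mem_apply_eq_of_isLUB hne hdir hs n
  exact ⟨b, hb, has.trans hbs.ge⟩

/-- The least extensions of the components of `m` form a chain with supremum `m`; so a Scott-open
neighbourhood of `m` contains one of them, and everything above it. -/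
theorem exists_setOf_le_apply_subset {U : Set (ModalDom Act)}
    (hU : IsOpen[scott (ModalDom Act) univ] U) {m : ModalDom Act} (hm : m ∈ U) :
    ∃ n, {y : ModalDom Act | m.1 n ≤ y.1 n} ⊆ U := by
  obtain ⟨hup, hacc⟩ := isOpen_scott_iff.1 hU
  choose j hj hjle using fun n => exists_least_extension n (m.1 n)
  have hmono : Monotone j := monotone_nat_of_le_succ fun n => hjle n _ <| by
    rw [← (j (n + 1)).proj_apply, hj (n + 1), m.proj_apply]
  have hlub : IsLUB (range j) m := by
    refine ⟨forall_mem_range.2 fun n => hjle n m le_rfl, fun y hy n => ?_⟩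
    rw [← hj n]
    exact hy (mem_range_self n) n
  obtain ⟨_, ⟨n, rfl⟩, hn⟩ :=
    hacc _ (range_nonempty j) (directedOn_range.2 hmono.directed_le) m hlub hm
  exact ⟨n, fun y hy => hup (hjle n y hy) hn⟩

theorem isClopen_preimage_setOf_le_apply (n : ℕ) (a : stage Act n) :
    IsClopen (MaximalPoints.val (D := ModalDom Act) ⁻¹' {y | a ≤ y.1 n}) := by
  refine ⟨⟨?_⟩, MaximalPoints.isOpen_preimage (isOpen_scott_setOf_le_apply n a)⟩
  -- By maximality of `y.val.1 n`, the condition `b ≤ y.val.1 n` with `b` maximal fixes that value.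
  have : (MaximalPoints.val (D := ModalDom Act) ⁻¹' {y | a ≤ y.1 n})ᶜ =
      ⋃ b ∈ {b : stage Act n | IsMax b ∧ ¬ a ≤ b},
        MaximalPoints.val (D := ModalDom Act) ⁻¹' {y | b ≤ y.1 n} := by
    ext y
    simp only [mem_compl_iff, mem_preimage, mem_ofPred_eq, mem_iUnion, exists_prop]
    constructor
    · exact fun h => ⟨y.val.1 n, ⟨isMax_apply y.isMax_val n, h⟩, le_rfl⟩
    · rintro ⟨b, ⟨hb, hab⟩, hby⟩ hay
      exact hab (hay.trans (hb hby))
  rw [this]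
  exact isOpen_biUnion fun b _ =>
    MaximalPoints.isOpen_preimage (isOpen_scott_setOf_le_apply n b)

variable (Act) in
theorem isZeroDimensional_and_t2Space :
    IsZeroDimensional (MaximalPoints (ModalDom Act)) ∧ T2Space (MaximalPoints (ModalDom Act)) := by
  refine isZeroDimensional_and_t2Space_of_clopen_nhds fun U hU m hm => ?_
  obtain ⟨n, hn⟩ := exists_setOf_le_apply_subset hU hm
  exact ⟨_, hn, le_rfl, isClopen_preimage_setOf_le_apply n _⟩

end ModalDom

end Stage

end ModalDomain

theorem mainTheorem8 (Act : Type*) [Finite Act] :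
    (ModalDomain.IsZeroDimensional (ModalDomain.MaximalPoints (ModalDomain.ModalDom Act)) ∧
      T2Space (ModalDomain.MaximalPoints (ModalDomain.ModalDom Act))) ∧
    (∀ (D : Type*) [PartialOrder D],
      ModalDomain.IsAlgebraicDomain D → ModalDomain.LawsonCondition D →
        ModalDomain.IsZeroDimensional (ModalDomain.MaximalPoints D) ∧
          T2Space (ModalDomain.MaximalPoints D)) :=
  ⟨ModalDomain.ModalDom.isZeroDimensional_and_t2Space Act,
    fun _ _ hD hL => hD.isZeroDimensional_and_t2Space hL⟩
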